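/- All Lie groups are finite dimensional; "complex Lie subgroup" means an injectively immersed, not necessarily closed, complex Lie group, with its own Lie group topology. If $A$ is a complex Lie subgroup of a complex Lie group $C$ and $x\in C$, the double coset $AxA$ is given the quotient topology of the orbit map $A\times A\to AxA$, $(a,b)\mapsto axb$. **Theorem.** Let $G$ be a connected complex Poisson–Lie group, i.e. a connected complex Lie group with a holomorphic Poisson bivector field $\pi$ for which the multiplication $G\times G\to G$ is a Poisson map. Let $\mathfrak g=\mathrm{Lie}(G)$ with its tangent Lie bialgebra structure: the cobracket $\delta:\mathfrak g\to\wedge^2\mathfrak g$ is the derivative at the identity of $g\mapsto R_{g^{-1}}\pi_g$ (where $R_{g^{-1}}$ is the differential of right translation by $g^{-1}$), and $\mathfrak g^*$ has the Lie bracket dual to $\delta$. Let $\mathrm D(\mathfrak g)=\mathfrak g\dotplus\mathfrak g^*$ (direct sum of vector spaces) be the classical double, that is, the Lie algebra that contains $\mathfrak g$ and $\mathfrak g^*$ as Lie subalgebras and for which the inner product given by the pairing of $\mathfrak g$ with $\mathfrak g^*$, and zero on $\mathfrak g\times\mathfrak g$ and $\mathfrak g^*\times\mathfrak g^*$, is invariant.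 Let $\mathrm D(G)$ be a double of $G$: a connected complex Lie group with $\mathrm{Lie}(\mathrm D(G))=\mathrm D(\mathfrak g)$ for which the inclusion $\mathfrak g\hookrightarrow\mathrm D(\mathfrak g)$ integrates to an injective (not necessarily proper) embedding of complex Lie groups $i:G\to\mathrm D(G)$. Let $G^r$ be the connected complex Lie subgroup of $\mathrm D(G)$ with Lie algebra $\mathfrak g^*\subset\mathrm D(\mathfrak g)$. Then for every $x\in\mathrm D(G)$ the intersection $G^rxG^r\cap i(G)G^r$ is a dense, open and connected (in particular nonempty) subset of the double coset $G^rxG^r$. **Lemma.** Let $C$ be a connected complex Lie group and let $A,B$ be complex Lie subgroups of $C$ such that $\mathrm{Lie}(C)$ is the direct sum of the vector subspaces $\mathrm{Lie}(A)$ and $\mathrm{Lie}(B)$. Then for every $x\in C$ the intersection $AxA\cap BA$ is a dense, open subset of $AxA$, and it is connected (in particular nonempty) if $A$ is connected. -/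

import Mathlib

open scoped Manifold ContDiff Pointwise

namespace PoissonLie

/-- A finite-dimensional complex normed space is complete.  (Mathlib has this fact, but not as an
instance; it is needed so that the Lie algebra of a complex Lie group is found.) -/
instance completeSpace_of_finiteDimensional {E : Type*} [NormedAddCommGroup E] [NormedSpace ℂ E]
    [FiniteDimensional ℂ E] : CompleteSpace E :=
  FiniteDimensional.complete ℂ E

/-! ### Holomorphic Poisson structures

Complex manifolds are modelled on finite-dimensional complex normed spaces, and "holomorphic" is
expressed as `ContMDiff` of class `ω` over `ℂ`. -/

section Poisson

variable {E : Type*} [NormedAddCommGroup E] [NormedSpace ℂ E]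
  {H : Type*} [TopologicalSpace H] (I : ModelWithCorners ℂ E H)
  (M : Type*) [TopologicalSpace M] [ChartedSpace H M]
  {E' : Type*} [NormedAddCommGroup E'] [NormedSpace ℂ E']
  {H' : Type*} [TopologicalSpace H'] (I' : ModelWithCorners ℂ E' H')
  (N : Type*) [TopologicalSpace N] [ChartedSpace H' N]

/-- The cotangent space of `M` at `x`. -/
abbrev Cotangent {M : Type*} [TopologicalSpace M] [ChartedSpace H M] (x : M) : Type _ :=
  Module.Dual ℂ (TangentSpace I x)

/-- A field of contravariant 2-tensors on `M`, a tensor in `T_x M ⊗ T_x M` being regarded as a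
bilinear form on the cotangent space at `x`. -/
abbrev TwoTensorField : Type _ :=
  ∀ x : M, Cotangent I x →ₗ[ℂ] Cotangent I x →ₗ[ℂ] ℂ

variable {M N}

/-- The differential at `x` of a complex-valued function. -/
noncomputable def differential (f : M → ℂ) (x : M) : Cotangent I x :=
  (NormedSpace.fromTangentSpace (𝕜 := ℂ) (f x)).toLinearEquiv.toLinearMap ∘ₗ
    (mfderiv I 𝓘(ℂ, ℂ) f x).toLinearMap

/-- The bracket `{f, h}(x) = π_x (d_x f, d_x h)`. -/
noncomputable def poissonBracket (π : TwoTensorField I M) (f h : M → ℂ) (x : M) : ℂ :=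
  π x (differential I f x) (differential I h x)

/-- `π` is a holomorphic Poisson bivector field: it is skew, it sends pairs of (locally defined)
holomorphic functions to holomorphic functions, and the bracket of locally defined holomorphic
functions satisfies the Jacobi identity. -/
structure IsPoissonBivector (π : TwoTensorField I M) : Prop where
  alternating : ∀ (x : M) (ξ : Cotangent I x), π x ξ ξ = 0
  holomorphic : ∀ (U : Set M), IsOpen U → ∀ f h : M → ℂ,
    ContMDiffOn I 𝓘(ℂ, ℂ) ω f U → ContMDiffOn I 𝓘(ℂ, ℂ) ω h U →
      ContMDiffOn I 𝓘(ℂ, ℂ) ω (poissonBracket I π f h) U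
  jacobi : ∀ (U : Set M), IsOpen U → ∀ f g h : M → ℂ,
    ContMDiffOn I 𝓘(ℂ, ℂ) ω f U → ContMDiffOn I 𝓘(ℂ, ℂ) ω g U → ContMDiffOn I 𝓘(ℂ, ℂ) ω h U →
      ∀ x ∈ U,
        poissonBracket I π f (poissonBracket I π g h) x +
        poissonBracket I π g (poissonBracket I π h f) x +
        poissonBracket I π h (poissonBracket I π f g) x = 0

/-- The pullback of a covector along the differential of `F` at `x`. -/
noncomputable def pullbackCovector (F : M → N) (x : M) (ξ : Cotangent I' (F x)) : Cotangent I x :=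
  ξ ∘ₗ (mfderiv I I' F x).toLinearMap

/-- The product bivector field `π ⊕ π'` on `M × N`: its value on two covectors at `(x, y)` is the
sum of the values of `π` and of `π'` on their restrictions to the two slices through `(x, y)`. -/
noncomputable def prodBivector (π : TwoTensorField I M) (π' : TwoTensorField I' N)
    (p : M × N) (ξ η : Cotangent (I.prod I') p) : ℂ :=
  π p.1 (pullbackCovector I (I.prod I') (fun x : M => (x, p.2)) p.1 ξ)
      (pullbackCovector I (I.prod I') (fun x : M => (x, p.2)) p.1 η) +
  π' p.2 (pullbackCovector I' (I.prod I') (fun y : N => (p.1, y)) p.2 ξ)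
      (pullbackCovector I' (I.prod I') (fun y : N => (p.1, y)) p.2 η)

end Poisson

/-! ### Poisson–Lie groups and their tangent Lie bialgebras -/

section Group

variable {E : Type*} [NormedAddCommGroup E] [NormedSpace ℂ E]
  {H : Type*} [TopologicalSpace H] (I : ModelWithCorners ℂ E H)
  {G : Type*} [TopologicalSpace G] [ChartedSpace H G] [Group G]

/-- `π` makes the complex Lie group `G` a Poisson–Lie group: it is a holomorphic Poisson bivector
field and the multiplication `G × G → G` is a Poisson map. -/
structure IsPoissonLie (π : TwoTensorField I G) : Prop extends IsPoissonBivector I π where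
  mul_poisson : ∀ (p : G × G) (ξ η : Cotangent I (p.1 * p.2)),
    π (p.1 * p.2) ξ η =
      prodBivector I I π π p
        (pullbackCovector (I.prod I) I (fun q : G × G => q.1 * q.2) p ξ)
        (pullbackCovector (I.prod I) I (fun q : G × G => q.1 * q.2) p η)

/-- The value at `g` of the right-invariant 1-form on `G` whose value at the identity is `ξ`, that
is, the pullback of `ξ` along `y ↦ y * g⁻¹` (which maps `g` to the identity; the tangent spaces at
`g * g⁻¹` and at `1` are the same type, and are identified by `g * g⁻¹ = 1`). -/
noncomputable def rightInvariantForm (ξ : Cotangent I (1 : G)) (g : G) : Cotangent I g :=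
  pullbackCovector I I (fun y : G => y * g⁻¹) g ξ

/-- The function `g ↦ (R_{g⁻¹} π_g)(ξ, η)`, the right-trivialised bivector field. -/
noncomputable def trivializedBivector (π : TwoTensorField I G) (ξ η : Cotangent I (1 : G))
    (g : G) : ℂ :=
  π g (rightInvariantForm I ξ g) (rightInvariantForm I η g)

/-- The Lie cobracket `δ : 𝔤 → ∧² 𝔤` of the tangent Lie bialgebra of a Poisson–Lie group:
the derivative at the identity of the right-trivialised bivector field. As for bivector fields,
`δ a` is regarded as a form on `𝔤* × 𝔤*`. -/
noncomputable def tangentCobracket (π : TwoTensorField I G) (a : GroupLieAlgebra I G)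
    (ξ η : Module.Dual ℂ (GroupLieAlgebra I G)) : ℂ :=
  differential I (trivializedBivector I π ξ η) 1 a

/-- The bracket on `𝔤*` dual to the cobracket: `[ξ, η](a) = δ(a)(ξ, η)`. -/
noncomputable def tangentDualBracket (π : TwoTensorField I G)
    (ξ η : Module.Dual ℂ (GroupLieAlgebra I G)) : Module.Dual ℂ (GroupLieAlgebra I G) where
  toFun a := tangentCobracket I π a ξ η
  map_add' a b := map_add (differential I (trivializedBivector I π ξ η) 1) a b
  map_smul' c a := map_smul (differential I (trivializedBivector I π ξ η) 1) c a

end Group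

/-! ### The classical double -/

section Double

variable {𝔤 : Type*} [LieRing 𝔤] [LieAlgebra ℂ 𝔤] {𝔡 : Type*} [LieRing 𝔡] [LieAlgebra ℂ 𝔡]

/-- The inner product on `𝔤 ∔ 𝔤*` given by the pairing between `𝔤` and `𝔤*` and trivial
otherwise. -/
def doublePairing (u v : 𝔤 × Module.Dual ℂ 𝔤) : ℂ := u.2 v.1 + v.2 u.1

/-- The linear isomorphism `φ` identifies the Lie algebra `𝔡` with the classical (Drinfeld) double
`𝔤 ∔ 𝔤*` of the Lie bialgebra `𝔤` whose cobracket is dual to the bracket `dualBracket` on `𝔤*`: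
`𝔤` and `𝔤*` are embedded as Lie subalgebras and the canonical inner product is invariant under
the adjoint action. (These requirements determine the Lie bracket of the double.) -/
structure IsClassicalDouble
    (dualBracket : Module.Dual ℂ 𝔤 → Module.Dual ℂ 𝔤 → Module.Dual ℂ 𝔤)
    (φ : (𝔤 × Module.Dual ℂ 𝔤) ≃ₗ[ℂ] 𝔡) : Prop where
  lie_left : ∀ a b : 𝔤, ⁅φ (a, 0), φ (b, 0)⁆ = φ (⁅a, b⁆, 0)
  lie_right : ∀ ξ η : Module.Dual ℂ 𝔤, ⁅φ (0, ξ), φ (0, η)⁆ = φ (0, dualBracket ξ η)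
  invariant : ∀ u v w : 𝔤 × Module.Dual ℂ 𝔤,
    doublePairing (φ.symm ⁅φ u, φ v⁆) w + doublePairing v (φ.symm ⁅φ u, φ w⁆) = 0

end Double

/-! ### Lie subgroups and double cosets -/

section Subgroup

variable {E : Type*} [NormedAddCommGroup E] [NormedSpace ℂ E]
  {H : Type*} [TopologicalSpace H] (I : ModelWithCorners ℂ E H)
  {A : Type*} [TopologicalSpace A] [ChartedSpace H A] [Group A]
  {E' : Type*} [NormedAddCommGroup E'] [NormedSpace ℂ E']
  {H' : Type*} [TopologicalSpace H'] (I' : ModelWithCorners ℂ E' H')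
  {C : Type*} [TopologicalSpace C] [ChartedSpace H' C] [Group C]

/-- The homomorphism `α : A → C` exhibits the complex Lie group `A` as an (immersed, not
necessarily closed) complex Lie subgroup of `C`: it is an injective holomorphic immersion. -/
structure IsLieSubgroup (α : A →* C) : Prop where
  injective : Function.Injective α
  holomorphic : ContMDiff I I' ω α
  immersion : ∀ a : A, Function.Injective (mfderiv I I' α a)

/-- The linear map `Lie A → Lie C` induced by a homomorphism `α`: its differential at the identity
(which takes values in the tangent space at `α 1`, the same as the one at `1`). -/
noncomputable def lieMap (α : A →* C) : GroupLieAlgebra I A →ₗ[ℂ] GroupLieAlgebra I' C :=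
  (mfderiv I I' α 1).toLinearMap

/-- The image of `Lie A` in `Lie C`. -/
noncomputable def lieRange (α : A →* C) : Submodule ℂ (GroupLieAlgebra I' C) :=
  LinearMap.range (lieMap I I' α)

end Subgroup

section Coset

variable {A C : Type*} [Group A] [Group C]

/-- The double coset `A x A` in `C`, where `A` is regarded as a subgroup of `C` by means of `α`. -/
abbrev selfCoset (α : A →* C) (x : C) : Set C :=
  DoubleCoset.doubleCoset x (Set.range α) (Set.range α)

/-- The orbit map `A × A → A x A`, `(a, b) ↦ a x b`. -/
def cosetMap (α : A →* C) (x : C) (p : A × A) : selfCoset α x :=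
  ⟨α p.1 * x * α p.2, DoubleCoset.mem_doubleCoset.2 ⟨_, ⟨p.1, rfl⟩, _, ⟨p.2, rfl⟩, rfl⟩⟩

/-- The topology of the double coset `A x A` as an orbit of the Lie group `A × A`, namely the
quotient topology induced by the orbit map. -/
abbrev cosetTopology [TopologicalSpace A] (α : A →* C) (x : C) :
    TopologicalSpace (selfCoset α x) :=
  TopologicalSpace.coinduced (cosetMap α x) inferInstance

/-- The intersection `A x A ∩ B A`, as a subset of `A x A`. -/
def cosetInter {B : Type*} [Group B] (α : A →* C) (β : B →* C) (x : C) : Set (selfCoset α x) :=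
  Subtype.val ⁻¹' (Set.range β * Set.range α)

end Coset

end PoissonLie

namespace PoissonLie

section

open Set Filter Topology Metric

/-! ### Complements of zero sets of holomorphic functions -/

section ComplexAnalysis

/-! Let `B × A` act on `C` by `c ↦ b c a⁻¹`. The orbit of `c` is open as soon as `Ad(c⁻¹) Lie B +
Lie A = Lie C`. Both sides have the same dimension by complementarity, so this condition is the
nonvanishing of a determinant `f(c)`, holomorphic in `c`, with `f(1) ≠ 0`. In a connected complex
manifold the zero set of a nonzero holomorphic function has empty interior and does not disconnect.
Hence `U = {f ≠ 0}` is open, dense and connected. It is partitioned by its traces on the orbits,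
which are open, so it lies in the single orbit `BA` of the identity
(`submersive_subset_range_mul_range`).

For a given `x`, consider the set of `a` with `ax ∈ BA`. It contains `T = {a | f(ax) ≠ 0}`. As `U`
is stable under left multiplication by `B` and `BV` is a neighbourhood of `1` for every
neighbourhood `V` of `1` in `A`, density of `U` in `C` forces density of `T` in `A`. If `A` is
connected, so is `T`, and then so is every set between `T` and its closure
(`isOpen_dense_preconnected_slice`).

Since `BA` absorbs right factors from `A`, the preimage of `AxA ∩ BA` in `A × A` is this slice times
`A`, and the three properties descend to the quotient. The Poisson–Lie statement is the case `A =
Gʳ`, `B = G`. -/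

theorem countable_zeros {f : ℂ → ℂ} {U : Set ℂ} (hf : AnalyticOnNhd ℂ f U)
    (hU : IsPreconnected U) {z₀ : ℂ} (hz₀ : z₀ ∈ U) (h0 : f z₀ ≠ 0) :
    (U ∩ {z | f z = 0}).Countable := by
  -- Zeros are isolated by the identity theorem, and a discrete subset of `ℂ` is countable because
  -- it is Lindelöf.
  have hd : DiscreteTopology ↥(U ∩ {z | f z = 0}) := by
    rw [discreteTopology_subtype_iff]
    rintro z ⟨hzU, -⟩
    rcases (hf z hzU).eventually_eq_zero_or_eventually_ne_zero with h | h
    · exact absurd (hf.eqOn_zero_of_preconnected_of_eventuallyEq_zero hU hzU h hz₀) h0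
    · rw [← disjoint_iff, disjoint_principal_right]
      filter_upwards [h] with w hw hw'
      exact hw hw'.2
  exact countable_coe_iff.1 (countable_of_Lindelof_of_discrete (X := ↥(U ∩ {z | f z = 0})))

variable {E : Type*} [NormedAddCommGroup E] [NormedSpace ℂ E]

theorem differentiable_line (p v : E) : Differentiable ℂ fun z : ℂ => p + z • v := by
  fun_prop

theorem analyticOnNhd_comp_line {g : E → ℂ} {c : E} {r : ℝ}
    (hg : DifferentiableOn ℂ g (ball c r)) (p v : E) :
    AnalyticOnNhd ℂ (fun z : ℂ => g (p + z • v)) ((fun z : ℂ => p + z • v) ⁻¹' ball c r) :=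
  (hg.comp (differentiable_line p v).differentiableOn fun _ h => h).analyticOnNhd
    (isOpen_ball.preimage (differentiable_line p v).continuous)

theorem isPreconnected_line_preimage_ball (c : E) (r : ℝ) (p v : E) :
    IsPreconnected ((fun z : ℂ => p + z • v) ⁻¹' ball c r) := by
  let _ : NormedSpace ℝ E := NormedSpace.restrictScalars ℝ ℂ E
  refine Convex.isPreconnected fun x hx y hy a b ha hb hab => ?_
  have := (convex_ball c r) hx hy ha hb hab
  have e : p + (a • x + b • y) • v = a • (p + x • v) + b • (p + y • v) := by
    rw [smul_add, smul_add, add_smul, smul_assoc, smul_assoc]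
    nth_rw 1 [← one_smul ℝ p, ← hab, add_smul]
    abel
  simpa only [mem_preimage, e] using this

theorem eq_zero_on_ball {g : E → ℂ} {c : E} {r : ℝ} (hg : DifferentiableOn ℂ g (ball c r))
    {q : E} (hq : q ∈ ball c r) (h : g =ᶠ[𝓝 q] 0) {p : E} (hp : p ∈ ball c r) : g p = 0 := by
  have h0 : Tendsto (fun z : ℂ => q + z • (p - q)) (𝓝 0) (𝓝 q) := by
    simpa using (differentiable_line q (p - q)).continuous.tendsto 0
  have := (analyticOnNhd_comp_line hg q (p - q)).eqOn_zero_of_preconnected_of_eventuallyEq_zero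
    (isPreconnected_line_preimage_ball c r q (p - q)) (z₀ := 0) (by simpa using hq)
    (h0.eventually h) (x := 1) (by simpa using hp)
  simpa using this

/-- On the complex line through two points of the complement only countably many parameters are
zeros. Among the uncountably many parabolic arcs joining the two points, which meet only at their
ends, some arc avoids them all. -/
theorem isPreconnected_ball_inter_ne_zero {g : E → ℂ} {c : E} {r : ℝ}
    (hg : DifferentiableOn ℂ g (ball c r)) : IsPreconnected (ball c r ∩ {x | g x ≠ 0}) := by
  let _ : NormedSpace ℝ E := NormedSpace.restrictScalars ℝ ℂ E
  refine isPreconnected_of_forall_pair ?_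
  rintro p ⟨hp, hgp⟩ q ⟨hq, hgq⟩
  set v := q - p with hv
  have hcount := countable_zeros (analyticOnNhd_comp_line hg p v)
    (isPreconnected_line_preimage_ball c r p v) (z₀ := 0) (by simpa using hp) (by simpa using hgp)
  set Z := ((fun z : ℂ => p + z • v) ⁻¹' ball c r) ∩ {z | g (p + z • v) = 0}
  set ρ := max (dist p c) (dist q c)
  have hρ : 0 < r - ρ := sub_pos.2 (max_lt hp hq)
  -- An arc with parameter `t < δ` strays from the segment by at most `t‖v‖ < r - ρ`, so it stays in
  -- the ball. The `+ 1` covers `v = 0`.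
  set δ := (r - ρ) / (‖v‖ + 1)
  have hδ : 0 < δ := by positivity
  -- An interior point `z` of the arc `s + i t s(1 - s)` determines `t` as `im z / (re z (1 - re
  -- z))`, so each zero rules out at most one `t`.
  obtain ⟨t, ⟨ht0, htδ⟩, htZ⟩ : ∃ t ∈ Ioo 0 δ, t ∉ (fun z : ℂ => z.im / (z.re * (1 - z.re))) '' Z := by
    by_contra! hcon
    exact (Cardinal.Real.Ioo_countable_iff.1 ((hcount.image _).mono hcon)).not_gt hδ
  set γ : ℝ → ℂ := fun s => s + (t * (s * (1 - s)) : ℝ) * Complex.I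
  have hγc : Continuous fun s : ℝ => p + γ s • v := by fun_prop
  refine ⟨(fun s : ℝ => p + γ s • v) '' Icc 0 1, ?_, ⟨0, by simp, by simp [γ]⟩,
    ⟨1, by simp, by simp [γ, hv]⟩, isPreconnected_Icc.image _ hγc.continuousOn⟩
  rintro _ ⟨s, ⟨hs0, hs1⟩, rfl⟩
  have hmem : p + γ s • v ∈ ball c r := by
    have h1 : p + (s : ℂ) • v ∈ closedBall c ρ := by
      have := (convex_closedBall c ρ) (x := p) (mem_closedBall.2 (le_max_left _ _)) (y := q) (mem_closedBall.2 (le_max_right _ _))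
        (a := 1 - s) (b := s) (by linarith) hs0 (by ring)
      convert this using 1
      rw [hv, Complex.coe_smul, smul_sub, sub_smul, one_smul]
      abel
    have h2 : ‖(((t * (s * (1 - s)) : ℝ) : ℂ) * Complex.I) • v‖ < r - ρ := by
      rw [norm_smul, norm_mul, Complex.norm_I, mul_one, Complex.norm_real, Real.norm_of_nonneg
        (by have := sub_nonneg.2 hs1; positivity)]
      have hs : s * (1 - s) ≤ 1 := by nlinarith
      calc t * (s * (1 - s)) * ‖v‖ ≤ t * 1 * ‖v‖ := by gcongr
        _ ≤ t * (‖v‖ + 1) := by nlinarith [norm_nonneg v]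
        _ < δ * (‖v‖ + 1) := by gcongr
        _ = r - ρ := by simp only [δ]; field_simp
    have e : p + γ s • v - c = (p + (s : ℂ) • v - c) +
        (((t * (s * (1 - s)) : ℝ) : ℂ) * Complex.I) • v := by
      simp only [γ, add_smul]; abel
    rw [mem_closedBall, dist_eq_norm] at h1
    rw [mem_ball, dist_eq_norm, e]
    linarith [norm_add_le (p + (s : ℂ) • v - c) ((((t * (s * (1 - s)) : ℝ) : ℂ) * Complex.I) • v)]
  refine ⟨hmem, fun hz => ?_⟩
  rcases hs0.eq_or_lt with rfl | hs0
  · exact hgp (by simpa [γ] using hz)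
  rcases hs1.eq_or_lt with rfl | hs1
  · exact hgq (by simpa [γ, hv] using hz)
  refine htZ ⟨γ s, ⟨hmem, hz⟩, ?_⟩
  have : s * (1 - s) ≠ 0 := (mul_pos hs0 (sub_pos.2 hs1)).ne'
  have hre : (γ s).re = s := by simp [γ]
  have him : (γ s).im = t * (s * (1 - s)) := by simp only [γ, Complex.add_im, Complex.ofReal_im, Complex.mul_I_im, Complex.ofReal_re, zero_add]
  simp only [hre, him]
  field_simp

variable {M : Type*} [TopologicalSpace M] [ChartedSpace E M] [IsManifold 𝓘(ℂ, E) 1 M]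

theorem exists_nhds_isPreconnected_inter_ne_zero {g : M → ℂ}
    (hg : MDifferentiable 𝓘(ℂ, E) 𝓘(ℂ, ℂ) g) (p : M) :
    ∃ V : Set M, IsOpen V ∧ p ∈ V ∧ IsPreconnected (V ∩ {x | g x ≠ 0}) ∧
      ∀ q ∈ V, g =ᶠ[𝓝 q] 0 → ∀ x ∈ V, g x = 0 := by
  set e := chartAt E p
  obtain ⟨r, hr, hball⟩ := Metric.isOpen_iff.1 e.open_target _ (mem_chart_target E p)
  set c := e p
  have hd : DifferentiableOn ℂ (g ∘ e.symm) (ball c r) := by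
    rw [← mdifferentiableOn_iff_differentiableOn]
    exact hg.comp_mdifferentiableOn
      ((mdifferentiableOn_atlas_symm (chart_mem_atlas E p)).mono hball)
  refine ⟨e.source ∩ e ⁻¹' ball c r, e.isOpen_inter_preimage isOpen_ball,
    ⟨mem_chart_source E p, mem_ball_self hr⟩, ?_, ?_⟩
  · have h := (isPreconnected_ball_inter_ne_zero hd).image e.symm
      (e.continuousOn_symm.mono (inter_subset_left.trans hball))
    convert h using 1
    ext x
    constructor
    · rintro ⟨⟨hx, hxb⟩, hgx⟩
      exact ⟨e x, ⟨hxb, by simpa [e.left_inv hx] using hgx⟩, e.left_inv hx⟩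
    · rintro ⟨y, ⟨hy, hgy⟩, rfl⟩
      exact ⟨⟨e.map_target (hball hy), by simpa [e.right_inv (hball hy)] using hy⟩, hgy⟩
  · rintro q ⟨hq, hqb⟩ h x ⟨hx, hxb⟩
    have h' : (g ∘ e.symm) =ᶠ[𝓝 (e q)] 0 := by
      have ht := e.tendsto_symm hq
      exact ht.eventually h
    simpa [e.left_inv hx] using eq_zero_on_ball hd hqb h' hxb

/-- The set of points near which `g` vanishes identically is open, and closed by the local identity
theorem. It misses `x₀`, so it is empty. -/
theorem dense_ne_zero [PreconnectedSpace M] {g : M → ℂ}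
    (hg : MDifferentiable 𝓘(ℂ, E) 𝓘(ℂ, ℂ) g) {x₀ : M} (h₀ : g x₀ ≠ 0) :
    Dense {x | g x ≠ 0} := by
  have hclopen : IsClopen {q | g =ᶠ[𝓝 q] 0} := by
    refine ⟨⟨?_⟩, isOpen_setOfPred_eventually_nhds⟩
    rw [isOpen_iff_mem_nhds]
    intro p hp
    obtain ⟨V, hV, hpV, -, hz⟩ := exists_nhds_isPreconnected_inter_ne_zero hg p
    filter_upwards [hV.mem_nhds hpV] with q hq hq0
    exact hp (by filter_upwards [hV.mem_nhds hpV] with x hx using hz q hq hq0 x hx)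
  rcases isClopen_iff.1 hclopen with h | h
  · intro q
    rw [mem_closure_iff_frequently]
    intro hq
    have : q ∈ {q | g =ᶠ[𝓝 q] 0} := by
      filter_upwards [hq] with x hx using not_not.1 hx
    rw [h] at this
    exact this
  · have : x₀ ∈ {q | g =ᶠ[𝓝 q] 0} := h ▸ mem_univ _
    exact absurd this.self_of_nhds h₀

/-- If two open sets separated the complement, the closures of the two pieces would cover `M` by
density and so share a point. Near that point the complement is connected and meets both pieces, a
contradiction. -/
theorem isPreconnected_ne_zero [PreconnectedSpace M] {g : M → ℂ}
    (hg : MDifferentiable 𝓘(ℂ, E) 𝓘(ℂ, ℂ) g) (hd : Dense {x | g x ≠ 0}) :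
    IsPreconnected {x | g x ≠ 0} := by
  rw [isPreconnected_iff_subset_of_disjoint]
  intro u v hu hv huv hdisj
  by_contra! hcon
  obtain ⟨⟨a, ha, hau⟩, ⟨b, hb, hbv⟩⟩ :=
    And.intro (not_subset.1 hcon.1) (not_subset.1 hcon.2)
  have hS : IsOpen {x | g x ≠ 0} := isOpen_ne.preimage hg.continuous
  have hcov : (univ : Set M) ⊆ closure ({x | g x ≠ 0} ∩ u) ∪ closure ({x | g x ≠ 0} ∩ v) := by
    rw [← closure_union, ← inter_union_distrib_left, inter_eq_left.2 huv, hd.closure_eq]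
  obtain ⟨p, -, hpu, hpv⟩ := isPreconnected_closed_iff.1 isPreconnected_univ _ _
    isClosed_closure isClosed_closure hcov
    ⟨b, mem_univ _, subset_closure ⟨hb, (huv hb).resolve_right hbv⟩⟩
    ⟨a, mem_univ _, subset_closure ⟨ha, (huv ha).resolve_left hau⟩⟩
  obtain ⟨V, hV, hpV, hpre, -⟩ := exists_nhds_isPreconnected_inter_ne_zero hg p
  obtain ⟨y, hyV, hyS, hyu⟩ := mem_closure_iff.1 hpu V hV hpV
  obtain ⟨z, hzV, hzS, hzv⟩ := mem_closure_iff.1 hpv V hV hpV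
  obtain ⟨w, ⟨-, hw⟩, hwu, hwv⟩ := hpre u v hu hv (inter_subset_right.trans huv)
    ⟨y, ⟨hyV, hyS⟩, hyu⟩ ⟨z, ⟨hzV, hzS⟩, hzv⟩
  have : w ∈ {x | g x ≠ 0} ∩ (u ∩ v) := ⟨hw, hwu, hwv⟩
  rw [hdisj] at this
  exact this

end ComplexAnalysis

/-! ### Submersions are open; the determinant is holomorphic -/

theorem map_nhds_eq_of_surjective_mfderiv
    {E : Type*} [NormedAddCommGroup E] [NormedSpace ℂ E] [CompleteSpace E]
    {H : Type*} [TopologicalSpace H] {I : ModelWithCorners ℂ E H} [I.Boundaryless]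
    {M : Type*} [TopologicalSpace M] [ChartedSpace H M]
    {E' : Type*} [NormedAddCommGroup E'] [NormedSpace ℂ E'] [CompleteSpace E']
    {H' : Type*} [TopologicalSpace H'] {I' : ModelWithCorners ℂ E' H'} [I'.Boundaryless]
    {N : Type*} [TopologicalSpace N] [ChartedSpace H' N] {F : M → N} {p : M}
    (hF : ContMDiffAt I I' 1 F p) (hs : Function.Surjective (mfderiv I I' F p)) :
    map F (𝓝 p) = 𝓝 (F p) := by
  set W := writtenInExtChartAt I I' p F
  have hW : HasStrictFDerivAt W (mfderiv I I' F p : E →L[ℂ] E') (extChartAt I p p) := by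
    have h1 := (contMDiffAt_iff.1 hF).2
    rw [I.range_eq_univ, contDiffWithinAt_univ] at h1
    have h2 := h1.hasStrictFDerivAt one_ne_zero
    have h3 : (mfderiv I I' F p : E →L[ℂ] E') = fderiv ℂ W (extChartAt I p p) := by
      have hm : MDifferentiableAt I I' F p := hF.mdifferentiableAt one_ne_zero
      refine (if_pos hm : mfderiv I I' F p = fderivWithin ℂ W (range I) (extChartAt I p p)).trans ?_
      rw [I.range_eq_univ, fderivWithin_univ]
    exact (congrArg (fun L : E →L[ℂ] E' => HasStrictFDerivAt W L (extChartAt I p p)) h3).mpr h2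
  have h1 := hW.map_nhds_eq_of_surj (LinearMap.range_eq_top.2 hs)
  have hWp : W (extChartAt I p p) = extChartAt I' (F p) (F p) := by
    simp [W, writtenInExtChartAt]
  rw [hWp, ← map_extChartAt_nhds_of_boundaryless, ← map_extChartAt_nhds_of_boundaryless,
    Filter.map_map] at h1
  have h2 : W ∘ extChartAt I p =ᶠ[𝓝 p] extChartAt I' (F p) ∘ F := by
    filter_upwards [extChartAt_source_mem_nhds (I := I) p] with y hy
    simp only [W, writtenInExtChartAt, Function.comp_apply, (extChartAt I p).left_inv hy]
  rw [Filter.map_congr h2, ← Filter.map_map] at h1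
  have h3 := congrArg (map (extChartAt I' (F p)).symm) h1
  rw [Filter.map_map, Filter.map_map, Filter.map_map] at h3
  have hid : (extChartAt I' (F p)).symm ∘ extChartAt I' (F p) =ᶠ[𝓝 (F p)] id := by
    filter_upwards [extChartAt_source_mem_nhds (I := I') (F p)] with y hy
    exact (extChartAt I' (F p)).left_inv hy
  have hidF : ((extChartAt I' (F p)).symm ∘ extChartAt I' (F p)) ∘ F =ᶠ[𝓝 p] F :=
    hF.continuousAt.eventually hid
  rwa [Filter.map_congr hidF, Filter.map_congr hid, Filter.map_id] at h3

theorem differentiable_det {V : Type*} [NormedAddCommGroup V] [NormedSpace ℂ V]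
    [FiniteDimensional ℂ V] :
    Differentiable ℂ fun L : V →L[ℂ] V => LinearMap.det (L : V →ₗ[ℂ] V) := by
  set b := Module.finBasis ℂ V
  have h : (fun L : V →L[ℂ] V => LinearMap.det (L : V →ₗ[ℂ] V)) = fun L =>
      ∑ σ : Equiv.Perm (Fin (Module.finrank ℂ V)), ((Equiv.Perm.sign σ : ℤ) : ℂ) *
        ∏ i, (b.coord (σ i)).toContinuousLinearMap (L (b i)) := by
    ext L
    rw [← LinearMap.det_toMatrix b, Matrix.det_apply']
    simp [LinearMap.toMatrix_apply]
  rw [h]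
  refine Differentiable.fun_sum fun σ _ => ?_
  refine Differentiable.const_mul ?_ _
  fun_prop

/-! ### The two-sided orbit map and its differential -/

section DoubleCosets

variable {E : Type*} [NormedAddCommGroup E] [NormedSpace ℂ E]
  {C : Type*} [TopologicalSpace C] [ChartedSpace E C] [Group C]
  {E₁ : Type*} [NormedAddCommGroup E₁] [NormedSpace ℂ E₁]
  {A : Type*} [TopologicalSpace A] [ChartedSpace E₁ A] [Group A]
  {E₂ : Type*} [NormedAddCommGroup E₂] [NormedSpace ℂ E₂]
  {B : Type*} [TopologicalSpace B] [ChartedSpace E₂ B] [Group B]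

/-- The orbit map `(b, a) ↦ b c a`, translated by `c⁻¹` so that it sends the identity to the
identity. -/
def twistedMul (α : A →* C) (β : B →* C) (c : C) (p : B × A) : C := c⁻¹ * β p.1 * c * α p.2

omit [TopologicalSpace C] [TopologicalSpace A] [TopologicalSpace B] in
@[simp] theorem twistedMul_one (α : A →* C) (β : B →* C) (c : C) : twistedMul α β c 1 = 1 := by
  simp [twistedMul]

variable (E E₁ E₂) in
/-- The differential of `twistedMul α β c` at the identity. -/
noncomputable def twistedDeriv (α : A →* C) (β : B →* C) (c : C) : (E₂ × E₁) →L[ℂ] E :=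
  mfderiv (𝓘(ℂ, E₂).prod 𝓘(ℂ, E₁)) 𝓘(ℂ, E) (twistedMul α β c) (1 : B × A)

variable {α : A →* C} {β : B →* C}

section Smooth

variable [LieGroup 𝓘(ℂ, E) ω C]

theorem contMDiff_uncurry_twistedMul (hα : ContMDiff 𝓘(ℂ, E₁) 𝓘(ℂ, E) ω α)
    (hβ : ContMDiff 𝓘(ℂ, E₂) 𝓘(ℂ, E) ω β) :
    ContMDiff (𝓘(ℂ, E).prod (𝓘(ℂ, E₂).prod 𝓘(ℂ, E₁))) 𝓘(ℂ, E) ω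
      (Function.uncurry (twistedMul α β)) :=
  ((contMDiff_fst.inv.mul (hβ.comp (contMDiff_fst.comp contMDiff_snd))).mul contMDiff_fst).mul
    (hα.comp (contMDiff_snd.comp contMDiff_snd))

theorem contMDiff_twistedMul (hα : ContMDiff 𝓘(ℂ, E₁) 𝓘(ℂ, E) ω α)
    (hβ : ContMDiff 𝓘(ℂ, E₂) 𝓘(ℂ, E) ω β) (c : C) :
    ContMDiff (𝓘(ℂ, E₂).prod 𝓘(ℂ, E₁)) 𝓘(ℂ, E) ω (twistedMul α β c) :=
  (contMDiff_uncurry_twistedMul hα hβ).comp (contMDiff_const.prodMk contMDiff_id)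

theorem contMDiff_twistedDeriv [LieGroup 𝓘(ℂ, E₁) ω A] [LieGroup 𝓘(ℂ, E₂) ω B]
    (hα : ContMDiff 𝓘(ℂ, E₁) 𝓘(ℂ, E) ω α) (hβ : ContMDiff 𝓘(ℂ, E₂) 𝓘(ℂ, E) ω β) :
    ContMDiff 𝓘(ℂ, E) 𝓘(ℂ, (E₂ × E₁) →L[ℂ] E) 1 (twistedDeriv E E₁ E₂ α β) := by
  intro c₀
  have h := ContMDiffAt.mfderiv (m := 1) (n := ω) (x₀ := c₀) (twistedMul α β)
    (fun _ => (1 : B × A)) (contMDiff_uncurry_twistedMul hα hβ _) contMDiffAt_const le_top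
  refine h.congr_of_eventuallyEq (Eventually.of_forall fun c => Eq.symm ?_)
  -- Source point and image point are the identity for every `c`, so both coordinate changes are
  -- trivial and the derivative in coordinates is `twistedDeriv` itself.
  have hI := inTangentCoordinates_eq (I := 𝓘(ℂ, E₂).prod 𝓘(ℂ, E₁)) (I' := 𝓘(ℂ, E))
    (fun _ => (1 : B × A)) (fun x => twistedMul α β x 1) (twistedDeriv E E₁ E₂ α β)
    (x₀ := c₀) (x := c) (mem_chart_source _ _)
    (by simpa only [twistedMul_one] using mem_chart_source E (1 : C))
  refine hI.trans ?_
  refine ContinuousLinearMap.ext fun v => ?_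
  simp only [ContinuousLinearMap.comp_apply, twistedMul_one]
  rw [(tangentBundleCore _ _).coordChange_self, (tangentBundleCore _ _).coordChange_self]
  · exact mem_chart_source _ _
  · exact mem_chart_source _ _

theorem twistedDeriv_one_apply (hα : ContMDiff 𝓘(ℂ, E₁) 𝓘(ℂ, E) ω α)
    (hβ : ContMDiff 𝓘(ℂ, E₂) 𝓘(ℂ, E) ω β) (v : E₂ × E₁) :
    (twistedDeriv E E₁ E₂ α β 1 v : GroupLieAlgebra 𝓘(ℂ, E) C) =
      lieMap 𝓘(ℂ, E₂) 𝓘(ℂ, E) β v.1 + lieMap 𝓘(ℂ, E₁) 𝓘(ℂ, E) α v.2 := by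
  have h := mfderiv_prod_eq_add_apply (v := v)
    ((contMDiff_twistedMul hα hβ 1).mdifferentiable (by simp) (1 : B × A))
  have h1 : (fun z : B => twistedMul α β 1 (z, (1 : B × A).2)) = β := by
    funext z; simp [twistedMul]
  have h2 : (fun z : A => twistedMul α β 1 ((1 : B × A).1, z)) = α := by
    funext z; simp [twistedMul]
  rw [h1, h2] at h
  exact h

/-- Replacing `c` by `β b * c` amounts to precomposing the orbit map with conjugation by `b⁻¹` on
`B`, so the image of the differential at `β b * c` lies in the image at `c`. -/
theorem surjective_twistedDeriv_of_mul_left [LieGroup 𝓘(ℂ, E₂) ω B]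
    [LieGroup 𝓘(ℂ, E₁) ω A]
    (hα : ContMDiff 𝓘(ℂ, E₁) 𝓘(ℂ, E) ω α)
    (hβ : ContMDiff 𝓘(ℂ, E₂) 𝓘(ℂ, E) ω β) (b : B) (c : C)
    (h : Function.Surjective (twistedDeriv E E₁ E₂ α β (β b * c))) :
    Function.Surjective (twistedDeriv E E₁ E₂ α β c) := by
  set κ : B × A → B × A := fun p => (b⁻¹ * p.1 * b, p.2) with hκ
  have hκs : ContMDiff (𝓘(ℂ, E₂).prod 𝓘(ℂ, E₁)) (𝓘(ℂ, E₂).prod 𝓘(ℂ, E₁)) ω κ :=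
    ((contMDiff_const.mul contMDiff_fst).mul contMDiff_const).prodMk contMDiff_snd
  have hcomp : twistedMul α β (β b * c) = twistedMul α β c ∘ κ := by
    funext p
    simp [twistedMul, hκ, mul_assoc]
  have hκ1 : κ 1 = 1 := by simp [hκ]
  have hd : HasMFDerivAt (𝓘(ℂ, E₂).prod 𝓘(ℂ, E₁)) 𝓘(ℂ, E) (twistedMul α β c) (κ 1)
      (twistedDeriv E E₁ E₂ α β c : (E₂ × E₁) →L[ℂ] E) := by
    rw [hκ1]
    exact ((contMDiff_twistedMul hα hβ c).mdifferentiable (by simp) _).hasMFDerivAt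
  have hd2 := (hd.comp 1 (hκs.mdifferentiable (by simp) 1).hasMFDerivAt).mfderiv
  intro w
  obtain ⟨v, hv⟩ := h w
  rw [twistedDeriv, hcomp] at hv
  refine ⟨mfderiv (𝓘(ℂ, E₂).prod 𝓘(ℂ, E₁)) (𝓘(ℂ, E₂).prod 𝓘(ℂ, E₁)) κ 1 v, ?_⟩
  rw [← hv]
  exact (congrArg (fun L : (E₂ × E₁) →L[ℂ] E => L v) hd2).symm

/-- Submersions are open. The factor from `A` is confined to `V` because the density argument in `A`
must produce a point near a given one. -/
theorem mem_nhds_of_surjective_twistedDeriv [CompleteSpace E] [CompleteSpace E₁]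
    [CompleteSpace E₂] (hα : ContMDiff 𝓘(ℂ, E₁) 𝓘(ℂ, E) ω α)
    (hβ : ContMDiff 𝓘(ℂ, E₂) 𝓘(ℂ, E) ω β) {c : C}
    (h : Function.Surjective (twistedDeriv E E₁ E₂ α β c)) {V : Set A} (hV : V ∈ 𝓝 1) :
    range β * {c} * α '' V ∈ 𝓝 c := by
  have : IsTopologicalGroup C := topologicalGroup_of_lieGroup 𝓘(ℂ, E) ω
  have h1 := map_nhds_eq_of_surjective_mfderiv
    ((contMDiff_twistedMul hα hβ c).of_le le_top _) h
  have h2 : twistedMul α β c '' (univ ×ˢ V) ∈ 𝓝 (1 : C) := by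
    rw [← twistedMul_one α β c, ← h1]
    exact image_mem_map (prod_mem_nhds univ_mem hV)
  have h3 := image_mem_map (m := fun y => c * y) h2
  rw [map_mul_left_nhds_one] at h3
  refine mem_of_superset h3 ?_
  rintro _ ⟨_, ⟨⟨b, a⟩, ⟨-, ha⟩, rfl⟩, rfl⟩
  refine ⟨β b * c, ⟨_, ⟨b, rfl⟩, c, rfl, rfl⟩, α a, ⟨a, ha, rfl⟩, ?_⟩
  simp [twistedMul, mul_assoc]

end Smooth

end DoubleCosets

/-! ### The submersive locus and the orbit of the identity -/

section DoubleCosets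

variable {E : Type*} [NormedAddCommGroup E] [NormedSpace ℂ E] [FiniteDimensional ℂ E]
  {C : Type*} [TopologicalSpace C] [ChartedSpace E C] [Group C] [LieGroup 𝓘(ℂ, E) ω C]
  {E₁ : Type*} [NormedAddCommGroup E₁] [NormedSpace ℂ E₁] [FiniteDimensional ℂ E₁]
  {A : Type*} [TopologicalSpace A] [ChartedSpace E₁ A] [Group A] [LieGroup 𝓘(ℂ, E₁) ω A]
  {E₂ : Type*} [NormedAddCommGroup E₂] [NormedSpace ℂ E₂] [FiniteDimensional ℂ E₂]
  {B : Type*} [TopologicalSpace B] [ChartedSpace E₂ B] [Group B] [LieGroup 𝓘(ℂ, E₂) ω B]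
  {α : A →* C} {β : B →* C}

omit [FiniteDimensional ℂ E] [FiniteDimensional ℂ E₁] [FiniteDimensional ℂ E₂]
  [LieGroup 𝓘(ℂ, E₁) ω A] [LieGroup 𝓘(ℂ, E₂) ω B] in
theorem bijective_twistedDeriv_one (hα : IsLieSubgroup 𝓘(ℂ, E₁) 𝓘(ℂ, E) α)
    (hβ : IsLieSubgroup 𝓘(ℂ, E₂) 𝓘(ℂ, E) β)
    (hc : IsCompl (lieRange 𝓘(ℂ, E₁) 𝓘(ℂ, E) α) (lieRange 𝓘(ℂ, E₂) 𝓘(ℂ, E) β)) :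
    Function.Bijective (twistedDeriv E E₁ E₂ α β 1) := by
  have key := twistedDeriv_one_apply hα.holomorphic hβ.holomorphic
  constructor
  · refine (injective_iff_map_eq_zero (twistedDeriv E E₁ E₂ α β 1)).2 fun v hv => ?_
    have h1 : lieMap 𝓘(ℂ, E₂) 𝓘(ℂ, E) β v.1 + lieMap 𝓘(ℂ, E₁) 𝓘(ℂ, E) α v.2 = 0 :=
      (key v).symm.trans hv
    have h2 : lieMap 𝓘(ℂ, E₁) 𝓘(ℂ, E) α v.2 = 0 := by
      refine (Submodule.disjoint_def.1 hc.disjoint) _ ⟨v.2, rfl⟩ ?_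
      rw [eq_neg_of_add_eq_zero_right h1]
      exact neg_mem ⟨v.1, rfl⟩
    have h3 : lieMap 𝓘(ℂ, E₂) 𝓘(ℂ, E) β v.1 = 0 := by rwa [h2, add_zero] at h1
    exact Prod.ext ((map_eq_zero_iff (lieMap 𝓘(ℂ, E₂) 𝓘(ℂ, E) β) (hβ.immersion 1)).1 h3)
      ((map_eq_zero_iff (lieMap 𝓘(ℂ, E₁) 𝓘(ℂ, E) α) (hα.immersion 1)).1 h2)
  · intro w
    obtain ⟨_, ⟨a, rfl⟩, _, ⟨b, rfl⟩, h⟩ := Submodule.mem_sup.1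
      (hc.sup_eq_top ▸ Submodule.mem_top : (w : GroupLieAlgebra 𝓘(ℂ, E) C) ∈ _)
    exact ⟨(b, a), (key (b, a)).trans ((add_comm _ _).trans h)⟩

omit [FiniteDimensional ℂ E] in
/-- The points `c` at which the orbit map `(b, a) ↦ b c a` is submersive form the complement of the
zero set of a holomorphic function. -/
theorem exists_mdifferentiable_ne_zero_iff (hα : ContMDiff 𝓘(ℂ, E₁) 𝓘(ℂ, E) ω α)
    (hβ : ContMDiff 𝓘(ℂ, E₂) 𝓘(ℂ, E) ω β)
    (h1 : Function.Bijective (twistedDeriv E E₁ E₂ α β 1)) :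
    ∃ f : C → ℂ, MDifferentiable 𝓘(ℂ, E) 𝓘(ℂ, ℂ) f ∧
      ∀ c, f c ≠ 0 ↔ Function.Surjective (twistedDeriv E E₁ E₂ α β c) := by
  -- The differential at `1` serves as a fixed identification of source and target, turning each
  -- differential into an endomorphism with a determinant.
  set e : (E₂ × E₁) ≃L[ℂ] E := (LinearEquiv.ofBijective
    (twistedDeriv E E₁ E₂ α β 1 : (E₂ × E₁) →ₗ[ℂ] E) h1).toContinuousLinearEquiv
  have hd : Differentiable ℂ fun L : (E₂ × E₁) →L[ℂ] E =>
      LinearMap.det (((e.symm : E →L[ℂ] E₂ × E₁).comp L : (E₂ × E₁) →L[ℂ] E₂ × E₁) :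
        (E₂ × E₁) →ₗ[ℂ] E₂ × E₁) :=
    differentiable_det.comp (g := fun L : (E₂ × E₁) →L[ℂ] E₂ × E₁ =>
      LinearMap.det (L : (E₂ × E₁) →ₗ[ℂ] E₂ × E₁))
      (f := fun L : (E₂ × E₁) →L[ℂ] E => (e.symm : E →L[ℂ] E₂ × E₁).comp L)
      ((differentiable_const _).clm_comp differentiable_id)
  refine ⟨_, hd.mdifferentiable.comp
    ((contMDiff_twistedDeriv hα hβ).mdifferentiable one_ne_zero), fun c => ?_⟩
  rw [Function.comp_apply, ← isUnit_iff_ne_zero, ← LinearMap.isUnit_iff_isUnit_det,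
    Module.End.isUnit_iff]
  set L := twistedDeriv E E₁ E₂ α β c
  have hL : ⇑(((e.symm : E →L[ℂ] E₂ × E₁).comp L : (E₂ × E₁) →L[ℂ] E₂ × E₁) :
      (E₂ × E₁) →ₗ[ℂ] E₂ × E₁) = e.symm ∘ L := rfl
  rw [← EquivLike.comp_surjective L e.symm, ← hL]
  exact ⟨fun h => h.2, fun h => ⟨LinearMap.injective_iff_surjective.2 h, h⟩⟩

omit [LieGroup 𝓘(ℂ, E₁) ω A] [LieGroup 𝓘(ℂ, E₂) ω B] in
theorem isOpen_range_mul_range (hα : ContMDiff 𝓘(ℂ, E₁) 𝓘(ℂ, E) ω α)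
    (hβ : ContMDiff 𝓘(ℂ, E₂) 𝓘(ℂ, E) ω β)
    (h1 : Function.Surjective (twistedDeriv E E₁ E₂ α β 1)) :
    IsOpen (range β * range α) := by
  have : IsTopologicalGroup C := topologicalGroup_of_lieGroup 𝓘(ℂ, E) ω
  have h := mem_nhds_of_surjective_twistedDeriv hα hβ h1 univ_mem
  rw [isOpen_iff_mem_nhds]
  rintro _ ⟨_, ⟨b, rfl⟩, _, ⟨a, rfl⟩, rfl⟩
  have hcont : ContinuousAt (fun y => (β b)⁻¹ * y * (α a)⁻¹) (β b * α a) := by fun_prop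
  have h2 := hcont.preimage_mem_nhds (t := range β * {1} * α '' univ) (by simpa using h)
  refine mem_of_superset h2 ?_
  rintro y ⟨_, ⟨_, ⟨b', rfl⟩, _, rfl, rfl⟩, _, ⟨a', -, rfl⟩, hy⟩
  refine ⟨β (b * b'), ⟨_, rfl⟩, α (a' * a), ⟨_, rfl⟩, ?_⟩
  have hy' : β b' * α a' = (β b)⁻¹ * y * (α a)⁻¹ := by simpa using hy
  have : y = β b * (β b' * α a') * α a := by rw [hy']; group
  simp only [this, map_mul, mul_assoc]

omit [LieGroup 𝓘(ℂ, E₁) ω A] [LieGroup 𝓘(ℂ, E₂) ω B] in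
-- Orbits through submersive points contain neighbourhoods of those points, so both the orbit of `1`
-- and its complement in the submersive locus are open. Connectedness leaves only the orbit of `1`.
theorem submersive_subset_range_mul_range (hα : ContMDiff 𝓘(ℂ, E₁) 𝓘(ℂ, E) ω α)
    (hβ : ContMDiff 𝓘(ℂ, E₂) 𝓘(ℂ, E) ω β)
    (h1 : Function.Surjective (twistedDeriv E E₁ E₂ α β 1))
    (hpre : IsPreconnected {c | Function.Surjective (twistedDeriv E E₁ E₂ α β c)})
    (hopen : IsOpen {c | Function.Surjective (twistedDeriv E E₁ E₂ α β c)}) :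
    {c | Function.Surjective (twistedDeriv E E₁ E₂ α β c)} ⊆ range β * range α := by
  set U := {c | Function.Surjective (twistedDeriv E E₁ E₂ α β c)}
  by_contra hcon
  obtain ⟨c₁, hc₁, hc₁'⟩ := not_subset.1 hcon
  have hdiff : IsOpen (U \ (range β * range α)) := by
    rw [isOpen_iff_mem_nhds]
    rintro c ⟨hc, hc'⟩
    filter_upwards [hopen.mem_nhds hc, mem_nhds_of_surjective_twistedDeriv hα hβ hc univ_mem]
      with y hyU hy
    refine ⟨hyU, ?_⟩
    obtain ⟨_, ⟨_, ⟨b, rfl⟩, c, rfl, rfl⟩, _, ⟨a, -, rfl⟩, rfl⟩ := hy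
    rintro ⟨_, ⟨b', rfl⟩, _, ⟨a', rfl⟩, hy⟩
    refine hc' ⟨β (b⁻¹ * b'), ⟨_, rfl⟩, α (a' * a⁻¹), ⟨_, rfl⟩, ?_⟩
    have hy' : β b' * α a' = β b * c * α a := hy
    calc β (b⁻¹ * b') * α (a' * a⁻¹) = (β b)⁻¹ * (β b' * α a') * (α a)⁻¹ := by
          simp only [map_mul, map_inv, mul_assoc]
      _ = c := by rw [hy']; group
  obtain ⟨y, -, hy, hy'⟩ := hpre _ _ (isOpen_range_mul_range hα hβ h1) hdiff
    (fun c hc => by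
      by_cases h : c ∈ range β * range α
      exacts [Or.inl h, Or.inr ⟨hc, h⟩])
    ⟨1, h1, 1, ⟨1, map_one β⟩, 1, ⟨1, map_one α⟩, one_mul 1⟩ ⟨c₁, hc₁, hc₁, hc₁'⟩
  exact hy'.2 hy

theorem isOpen_dense_preconnected_slice [ConnectedSpace C]
    (hα : IsLieSubgroup 𝓘(ℂ, E₁) 𝓘(ℂ, E) α) (hβ : IsLieSubgroup 𝓘(ℂ, E₂) 𝓘(ℂ, E) β)
    (hc : IsCompl (lieRange 𝓘(ℂ, E₁) 𝓘(ℂ, E) α) (lieRange 𝓘(ℂ, E₂) 𝓘(ℂ, E) β)) (x : C) :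
    IsOpen {a | α a * x ∈ range β * range α} ∧ Dense {a | α a * x ∈ range β * range α} ∧
      (ConnectedSpace A → IsPreconnected {a | α a * x ∈ range β * range α}) := by
  have : IsTopologicalGroup C := topologicalGroup_of_lieGroup 𝓘(ℂ, E) ω
  have : IsTopologicalGroup A := topologicalGroup_of_lieGroup 𝓘(ℂ, E₁) ω
  have h1 := bijective_twistedDeriv_one hα hβ hc
  obtain ⟨f, hf, hfs⟩ := exists_mdifferentiable_ne_zero_iff hα.holomorphic hβ.holomorphic h1
  have hfset : {c | f c ≠ 0} = {c | Function.Surjective (twistedDeriv E E₁ E₂ α β c)} :=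
    Set.ext hfs
  have hdense : Dense {c | f c ≠ 0} := dense_ne_zero hf ((hfs 1).2 h1.2)
  have hsub : {c | f c ≠ 0} ⊆ range β * range α := by
    rw [hfset]
    refine submersive_subset_range_mul_range hα.holomorphic hβ.holomorphic h1.2 ?_ ?_
    · exact hfset ▸ isPreconnected_ne_zero hf hdense
    · exact hfset ▸ isOpen_ne.preimage hf.continuous
  have hαx : MDifferentiable 𝓘(ℂ, E₁) 𝓘(ℂ, E) fun a => α a * x :=
    (hα.holomorphic.mul contMDiff_const).mdifferentiable (by simp)
  -- Near `α a₀ * x` there is a point of the dense set of the form `β b * α (a * a₀) * x` with `a *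
  -- a₀ ∈ V`. Left invariance then removes `β b`.
  have hT : Dense {a | f (α a * x) ≠ 0} := by
    intro a₀
    rw [mem_closure_iff_nhds]
    intro V hV
    have hV' : (fun a => a * a₀) ⁻¹' V ∈ 𝓝 (1 : A) :=
      (continuous_mul_const a₀).continuousAt.preimage_mem_nhds (by simpa using hV)
    have hW := mem_nhds_of_surjective_twistedDeriv hα.holomorphic hβ.holomorphic h1.2 hV'
    have hW' : (fun y => y * (α a₀ * x)⁻¹) ⁻¹' (range β * {1} * α '' ((fun a => a * a₀) ⁻¹' V)) ∈
        𝓝 (α a₀ * x) :=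
      (continuous_mul_const (α a₀ * x)⁻¹).continuousAt.preimage_mem_nhds
        (by simpa only [mul_inv_cancel] using hW)
    obtain ⟨y, ⟨_, ⟨_, ⟨b, rfl⟩, _, rfl, rfl⟩, _, ⟨a, ha, rfl⟩, hy⟩, hfy⟩ :=
      mem_closure_iff_nhds.1 (hdense (α a₀ * x)) _ hW'
    refine ⟨a * a₀, ha, (hfs _).2 ?_⟩
    refine surjective_twistedDeriv_of_mul_left hα.holomorphic hβ.holomorphic b _ ?_
    have hy' : β b * α a = y * (α a₀ * x)⁻¹ := by simpa using hy
    have : β b * (α (a * a₀) * x) = y := by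
      rw [map_mul, mul_assoc (α a), ← mul_assoc, hy', inv_mul_cancel_right]
    rw [this]
    exact (hfs _).1 hfy
  have hTS : {a | f (α a * x) ≠ 0} ⊆ {a | α a * x ∈ range β * range α} := fun a ha => hsub ha
  refine ⟨(isOpen_range_mul_range hα.holomorphic hβ.holomorphic h1.2).preimage hαx.continuous,
    hT.mono hTS, fun _ => ?_⟩
  have hpre : IsPreconnected {a | f (α a * x) ≠ 0} := isPreconnected_ne_zero (hf.comp hαx) hT
  exact hpre.subset_closure hTS (by rw [hT.closure_eq]; exact subset_univ _)

end DoubleCosets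

/-! ### Descent to the double coset -/

theorem cosetMap_preimage_cosetInter {A B C : Type*} [Group A] [Group B] [Group C]
    (α : A →* C) (β : B →* C) (x : C) :
    cosetMap α x ⁻¹' cosetInter α β x = {a | α a * x ∈ range β * range α} ×ˢ univ := by
  ext ⟨a, a'⟩
  simp only [mem_preimage, cosetInter, cosetMap, mem_prod, mem_ofPred_eq, mem_univ, and_true]
  constructor
  · rintro ⟨_, ⟨b, rfl⟩, _, ⟨c, rfl⟩, h⟩
    refine ⟨β b, ⟨b, rfl⟩, α (c * a'⁻¹), ⟨_, rfl⟩, ?_⟩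
    have h' : β b * α c = α a * x * α a' := h
    simp only [map_mul, map_inv]
    rw [← mul_assoc, h', mul_inv_cancel_right]
  · rintro ⟨_, ⟨b, rfl⟩, _, ⟨c, rfl⟩, h⟩
    refine ⟨β b, ⟨b, rfl⟩, α (c * a'), ⟨_, rfl⟩, ?_⟩
    have h' : β b * α c = α a * x := h
    simp only [map_mul]
    rw [← mul_assoc, h']

theorem cosetMap_surjective {A C : Type*} [Group A] [Group C] (α : A →* C) (x : C) :
    Function.Surjective (cosetMap α x) := by
  rintro ⟨y, hy⟩
  obtain ⟨_, ⟨a, rfl⟩, _, ⟨b, rfl⟩, rfl⟩ := DoubleCoset.mem_doubleCoset.1 hy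
  exact ⟨(a, b), rfl⟩

theorem dense_of_dense_preimage {X Y : Type*} [TopologicalSpace X] [TopologicalSpace Y] {q : X → Y}
    (hq : Continuous q) (hs : Function.Surjective q) {S : Set Y} (h : Dense (q ⁻¹' S)) :
    Dense S := by
  rw [← image_preimage_eq S hs]
  exact hs.denseRange.dense_image hq h

theorem isConnected_of_isConnected_preimage {X Y : Type*} [TopologicalSpace X]
    [TopologicalSpace Y] {q : X → Y} (hq : Continuous q) (hs : Function.Surjective q) {S : Set Y}
    (h : IsConnected (q ⁻¹' S)) : IsConnected S := by
  rw [← image_preimage_eq S hs]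
  exact h.image q hq.continuousOn

theorem cosetInter_isOpen_dense_connected
    {E : Type*} [NormedAddCommGroup E] [NormedSpace ℂ E] [FiniteDimensional ℂ E]
    {C : Type*} [TopologicalSpace C] [ChartedSpace E C] [Group C] [LieGroup 𝓘(ℂ, E) ω C]
    [ConnectedSpace C]
    {E₁ : Type*} [NormedAddCommGroup E₁] [NormedSpace ℂ E₁] [FiniteDimensional ℂ E₁]
    {A : Type*} [TopologicalSpace A] [ChartedSpace E₁ A] [Group A] [LieGroup 𝓘(ℂ, E₁) ω A]
    {E₂ : Type*} [NormedAddCommGroup E₂] [NormedSpace ℂ E₂] [FiniteDimensional ℂ E₂]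
    {B : Type*} [TopologicalSpace B] [ChartedSpace E₂ B] [Group B] [LieGroup 𝓘(ℂ, E₂) ω B]
    (α : A →* C) (hα : IsLieSubgroup 𝓘(ℂ, E₁) 𝓘(ℂ, E) α)
    (β : B →* C) (hβ : IsLieSubgroup 𝓘(ℂ, E₂) 𝓘(ℂ, E) β)
    (hc : IsCompl (lieRange 𝓘(ℂ, E₁) 𝓘(ℂ, E) α) (lieRange 𝓘(ℂ, E₂) 𝓘(ℂ, E) β)) (x : C) :
    @IsOpen _ (cosetTopology α x) (cosetInter α β x) ∧
      @Dense _ (cosetTopology α x) (cosetInter α β x) ∧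
      (ConnectedSpace A → @IsConnected _ (cosetTopology α x) (cosetInter α β x)) := by
  obtain ⟨hopen, hdense, hpre⟩ := isOpen_dense_preconnected_slice hα hβ hc x
  have hcont : @Continuous _ _ _ (cosetTopology α x) (cosetMap α x) := continuous_coinduced_rng
  have hpreim := cosetMap_preimage_cosetInter α β x
  refine ⟨?_, ?_, fun hA => ?_⟩
  · rw [isOpen_coinduced, hpreim]
    exact hopen.prod isOpen_univ
  · exact @dense_of_dense_preimage _ _ _ (cosetTopology α x) _ hcont (cosetMap_surjective α x) _
      (hpreim ▸ hdense.prod dense_univ)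
  · exact @isConnected_of_isConnected_preimage _ _ _ (cosetTopology α x) _ hcont
      (cosetMap_surjective α x) _
      (hpreim ▸ ⟨hdense.nonempty.prod univ_nonempty, (hpre hA).prod isPreconnected_univ⟩)

theorem isCompl_lieRange_of_double {𝔤 𝔡 : Type*} [AddCommGroup 𝔤] [Module ℂ 𝔤] [AddCommGroup 𝔡]
    [Module ℂ 𝔡] (φ : (𝔤 × Module.Dual ℂ 𝔤) ≃ₗ[ℂ] 𝔡) {p q : Submodule ℂ 𝔡}
    (hp : ∀ v, v ∈ p ↔ ∃ ξ, φ (0, ξ) = v) (hq : ∀ v, v ∈ q ↔ ∃ a, φ (a, 0) = v) :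
    IsCompl p q := by
  refine ⟨Submodule.disjoint_def.2 fun v hvp hvq => ?_, codisjoint_iff.2 (eq_top_iff.2 ?_)⟩
  · obtain ⟨ξ, rfl⟩ := (hp v).1 hvp
    obtain ⟨a, ha⟩ := (hq _).1 hvq
    obtain ⟨-, rfl⟩ := Prod.mk.inj (φ.injective ha)
    exact map_zero φ
  · intro v _
    refine Submodule.mem_sup.2 ⟨φ (0, (φ.symm v).2), (hp _).2 ⟨_, rfl⟩,
      φ ((φ.symm v).1, 0), (hq _).2 ⟨_, rfl⟩, ?_⟩
    rw [← map_add]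
    simp

end

end PoissonLie

theorem mainTheorem6 :
    -- the statement for Poisson–Lie groups
    (∀ {E : Type*} [NormedAddCommGroup E] [NormedSpace ℂ E] [FiniteDimensional ℂ E]
      {G : Type*} [TopologicalSpace G] [ChartedSpace E G] [Group G]
      [LieGroup 𝓘(ℂ, E) ω G] [ConnectedSpace G]
      (π : PoissonLie.TwoTensorField 𝓘(ℂ, E) G) (_ : PoissonLie.IsPoissonLie 𝓘(ℂ, E) π)
      -- the double `D = D(G)`, with `φ` identifying the double of the Lie bialgebra with `Lie D`
      {E' : Type*} [NormedAddCommGroup E'] [NormedSpace ℂ E'] [FiniteDimensional ℂ E']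
      {D : Type*} [TopologicalSpace D] [ChartedSpace E' D] [Group D]
      [LieGroup 𝓘(ℂ, E') ω D] [ConnectedSpace D]
      (φ : (GroupLieAlgebra 𝓘(ℂ, E) G × Module.Dual ℂ (GroupLieAlgebra 𝓘(ℂ, E) G)) ≃ₗ[ℂ]
        GroupLieAlgebra 𝓘(ℂ, E') D)
      (_ : PoissonLie.IsClassicalDouble (PoissonLie.tangentDualBracket 𝓘(ℂ, E) π) φ)
      -- the embedding of `G` in `D(G)` that integrates the embedding of Lie algebras
      (i : G →* D) (_ : PoissonLie.IsLieSubgroup 𝓘(ℂ, E) 𝓘(ℂ, E') i)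
      (_ : ∀ a, PoissonLie.lieMap 𝓘(ℂ, E) 𝓘(ℂ, E') i a = φ (a, 0))
      -- the connected Lie subgroup `Gʳ` of `D(G)` whose Lie algebra is the image of the dual
      {F : Type*} [NormedAddCommGroup F] [NormedSpace ℂ F] [FiniteDimensional ℂ F]
      {Gr : Type*} [TopologicalSpace Gr] [ChartedSpace F Gr] [Group Gr]
      [LieGroup 𝓘(ℂ, F) ω Gr] [ConnectedSpace Gr]
      (κ : Gr →* D) (_ : PoissonLie.IsLieSubgroup 𝓘(ℂ, F) 𝓘(ℂ, E') κ)
      (_ : ∀ v, v ∈ PoissonLie.lieRange 𝓘(ℂ, F) 𝓘(ℂ, E') κ ↔ ∃ ξ, φ (0, ξ) = v)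
      (x : D),
      @IsOpen _ (PoissonLie.cosetTopology κ x) (PoissonLie.cosetInter κ i x) ∧
      @Dense _ (PoissonLie.cosetTopology κ x) (PoissonLie.cosetInter κ i x) ∧
      @IsConnected _ (PoissonLie.cosetTopology κ x) (PoissonLie.cosetInter κ i x)) ∧
    -- the general lemma
    (∀ {E : Type*} [NormedAddCommGroup E] [NormedSpace ℂ E] [FiniteDimensional ℂ E]
      {C : Type*} [TopologicalSpace C] [ChartedSpace E C] [Group C]
      [LieGroup 𝓘(ℂ, E) ω C] [ConnectedSpace C]
      {E₁ : Type*} [NormedAddCommGroup E₁] [NormedSpace ℂ E₁] [FiniteDimensional ℂ E₁]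
      {A : Type*} [TopologicalSpace A] [ChartedSpace E₁ A] [Group A] [LieGroup 𝓘(ℂ, E₁) ω A]
      {E₂ : Type*} [NormedAddCommGroup E₂] [NormedSpace ℂ E₂] [FiniteDimensional ℂ E₂]
      {B : Type*} [TopologicalSpace B] [ChartedSpace E₂ B] [Group B] [LieGroup 𝓘(ℂ, E₂) ω B]
      (α : A →* C) (_ : PoissonLie.IsLieSubgroup 𝓘(ℂ, E₁) 𝓘(ℂ, E) α)
      (β : B →* C) (_ : PoissonLie.IsLieSubgroup 𝓘(ℂ, E₂) 𝓘(ℂ, E) β)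
      (_ : IsCompl (PoissonLie.lieRange 𝓘(ℂ, E₁) 𝓘(ℂ, E) α)
        (PoissonLie.lieRange 𝓘(ℂ, E₂) 𝓘(ℂ, E) β))
      (x : C),
      @IsOpen _ (PoissonLie.cosetTopology α x) (PoissonLie.cosetInter α β x) ∧
      @Dense _ (PoissonLie.cosetTopology α x) (PoissonLie.cosetInter α β x) ∧
      (ConnectedSpace A →
        @IsConnected _ (PoissonLie.cosetTopology α x) (PoissonLie.cosetInter α β x))) := by

  refine ⟨?_, ?_⟩
  · intro E _ _ _ G _ _ _ _ _ π _ E' _ _ _ D _ _ _ _ _ φ _ i hi hia F _ _ _ Gr _ _ _ _ _ κ hκ hκr x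
    -- The splitting of the double into `𝔤*` and `𝔤` is the complementarity required of `Lie Gʳ` and
    -- `Lie G`.
    have h := PoissonLie.cosetInter_isOpen_dense_connected κ hκ i hi
      (PoissonLie.isCompl_lieRange_of_double φ hκr fun v =>
        ⟨fun ⟨a, ha⟩ => ⟨a, (hia a).symm.trans ha⟩, fun ⟨a, ha⟩ => ⟨a, (hia a).trans ha⟩⟩) x
    exact ⟨h.1, h.2.1, h.2.2 inferInstance⟩
  · intro E _ _ _ C _ _ _ _ _ E₁ _ _ _ A _ _ _ _ E₂ _ _ _ B _ _ _ _ α hα β hβ hc x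
    exact PoissonLie.cosetInter_isOpen_dense_connected α hα β hβ hc x
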